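/- **Setting.** Let $m\ge 0$ and, for $i=1,\dots,m$, let $n^i,T^i$ be natural numbers and let $y^i_1,\dots,y^i_{n^i}$ be distinct support points. Let $\mathcal P_{l}$ be the probability simplex in $\mathbb R^{l}$ and $\mathcal P=\prod_i\mathcal P_{n^i}$. For $\mathbf p=(\mathbf p^1,\dots,\mathbf p^m)\in\mathcal P$ let $\mathbf X=(X^i_t)_{1\le i\le m,\,1\le t\le T^i}$ be independent random variables with $P_{\mathbf p}(X^i_t=y^i_j)=p^i_j$, and put $Z(\mathbf p)=E_{\mathbf p}[h(\mathbf X)]$ for a real-valued function $h$ (which is automatically bounded on the finitely many sample paths). Put $$\psi^i_j(\mathbf p)=\frac{d}{d\epsilon}Z(\mathbf p^1,\dots,(1-\epsilon)\mathbf p^i+\epsilon\mathbf 1^i_j,\dots,\mathbf p^m)\Big|_{\epsilon=0},\qquad \boldsymbol\psi(\mathbf p)=(\psi^i_j(\mathbf p))_{i,j},$$ where $\mathbf 1^i_j$ is the point mass at $y^i_j$ and $\epsilon\in[0,1]$. Let $\hat{\mathcal U}=\prod_{i=1}^m\hat{\mathcal U}^i$ with closed convex sets $\hat{\mathcal U}^i\subseteq\mathcal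 P_{n^i}$, and let $g(\tilde{\mathbf p})=-\min_{\mathbf p\in\hat{\mathcal U}}\boldsymbol\psi(\tilde{\mathbf p})'(\mathbf p-\tilde{\mathbf p})$ be the Frank–Wolfe (FW) gap on $\hat{\mathcal U}$. **Algorithm.** Start from a deterministic $\mathbf p_1\in\mathcal P$ with all entries positive. In iteration $k=1,2,\dots$: given the past, simulate $R_k\ge1$ i.i.d. sample paths $\mathbf X_{k,1},\dots,\mathbf X_{k,R_k}$ of $\mathbf X$ under $\mathbf p_k$; let $$\hat\psi^i_j(\mathbf p_k)=\frac1{R_k}\sum_{r=1}^{R_k}h(\mathbf X_{k,r})\Big(\sum_{t=1}^{T^i}\frac{I\big((X_{k,r})^i_t=y^i_j\big)}{p^i_{k,j}}-T^i\Big);$$ choose (measurably) $\hat{\mathbf q}_k\in\operatorname{argmin}_{\mathbf p\in\hat{\mathcal U}}\hat{\boldsymbol\psi}(\mathbf p_k)'(\mathbf p-\mathbf p_k)$, and set $\mathbf p_{k+1}=(1-\epsilon_k)\mathbf p_k+\epsilon_k\hat{\mathbf q}_k$. **Theorem.** Assume $0\le\epsilon_k<1$ for all $k$, $\sum_{k}\epsilon_k=\infty$,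 $\sum_k\epsilon_k^2<\infty$ and $$\sum_{k=1}^\infty\frac{\epsilon_k}{\sqrt{R_k}}\prod_{j=1}^{k-1}(1-\epsilon_j)^{-1/2}<\infty .$$ 1. If $g$ is continuous on $\hat{\mathcal U}$ and $Z$ has a minimizer over $\hat{\mathcal U}$, then $\mathcal Z^*=\{Z(\mathbf p):\mathbf p\in\hat{\mathcal U},\ g(\mathbf p)=0\}$ is non-empty and $\inf_{z\in\mathcal Z^*}|Z(\mathbf p_k)-z|\to0$ almost surely. 2. If $Z$ has a unique minimizer $\mathbf p^*$ over $\hat{\mathcal U}$, $g$ is continuous on $\hat{\mathcal U}$, and $\mathbf p^*$ is the only point of $\hat{\mathcal U}$ at which $g$ vanishes, then $\mathbf p_k\to\mathbf p^*$ almost surely. -/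

import Mathlib

open Filter Topology MeasureTheory

namespace FWSA

/-- Concatenated weight vectors `p = vec(p^i : i = 1, …, m)`: the `i`-th input model has `n i` support
points, and `p i j` is the weight of its `j`-th support point `y^i_j`. -/
abbrev Weights {m : ℕ} (n : Fin m → ℕ) : Type := (i : Fin m) → Fin (n i) → ℝ

/-- Sample paths `x = (x^i_t)`, `1 ≤ t ≤ T^i`. The (distinct) support points of each input model are
identified with their indices: `x i t = j` means that the value of `x^i_t` is the support point `y^i_j`. -/
abbrev Path {m : ℕ} (n T : Fin m → ℕ) : Type := (i : Fin m) → Fin (T i) → Fin (n i)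

variable {m : ℕ} {n T : Fin m → ℕ}

/-- The product of probability simplices `𝒫 = ∏ 𝒫_{n^i}`. -/
def simplices (n : Fin m → ℕ) : Set (Weights n) :=
  Set.univ.pi fun i => stdSimplex ℝ (Fin (n i))

/-- The probability of the sample path `x` when all `X^i_t` are independent and `X^i_t` has
distribution `p^i`. -/
def pathProb (p : Weights n) (x : Path n T) : ℝ :=
  ∏ i, ∏ t, p i (x i t)

/-- The performance measure `Z(p) = E_p[h(X)]`. -/
def perf (h : Path n T → ℝ) (p : Weights n) : ℝ :=
  ∑ x, h x * pathProb p x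

/-- `ψ^i_j(p)`: the derivative at `ε = 0` of `Z(p^1, …, (1 - ε) p^i + ε 1^i_j, …, p^m)`, where
`ε ∈ [0, 1]` is the mixture parameter and `1^i_j` is the point mass at the `j`-th support point. -/
noncomputable def grad (h : Path n T → ℝ) (p : Weights n) : Weights n := fun i j =>
  derivWithin
    (fun e : ℝ => perf h (Function.update p i ((1 - e) • p i + e • Pi.single j (1 : ℝ))))
    (Set.Icc 0 1) 0

/-- The Euclidean pairing `v' w`. -/
def pairing (v w : Weights n) : ℝ := ∑ i, ∑ j, v i j * w i j

/-- The Frank-Wolfe gap `g(p) = - min_{q ∈ U} ψ(p)' (q - p)`. -/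
noncomputable def gap (h : Path n T → ℝ) (U : Set (Weights n)) (p : Weights n) : ℝ :=
  - sInf ((fun q => pairing (grad h p) (q - p)) '' U)

/-- The score `s^i_j(x^i) = ∑_t I(x^i_t = y^i_j) / p^i_j - T^i`. -/
noncomputable def score (p : Weights n) (x : Path n T) : Weights n := fun i j =>
  ∑ t, (if x i t = j then (1 : ℝ) else 0) / p i j - (T i : ℝ)

/-- The estimator `(1 / R) ∑_r h(X_r) s^i_j(X_r^i)` of `ψ^i_j(p)` from `R` sample paths. -/
noncomputable def gradEst (h : Path n T → ℝ) (p : Weights n) {R : ℕ} (X : Fin R → Path n T) :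
    Weights n := fun i j =>
  (1 / (R : ℝ)) * ∑ r, h (X r) * score p (X r) i j

/-- `p` is a minimizer of `f` over `U`. -/
def IsMinimizer (f : Weights n → ℝ) (U : Set (Weights n)) (p : Weights n) : Prop :=
  p ∈ U ∧ ∀ q ∈ U, f p ≤ f q

/-- A run of the Frank-Wolfe stochastic approximation algorithm with cost function `h`, feasible set
`U`, initial point `p₁`, step sizes `ε` and sample sizes `R`, on a probability space `(Ω, μ)`.
Iterations are numbered from `0`, so `p k`, `q k`, `ε k`, `R k` belong to the `(k+1)`-st iteration.
`ℱ k` is the information available when iteration `k` starts, `X k` are the sample paths simulated in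
iteration `k`, and `q k` is the solution of the subproblem of iteration `k`. -/
structure IsRun (h : Path n T → ℝ) (U : Set (Weights n)) (p₁ : Weights n) (ε : ℕ → ℝ) (R : ℕ → ℕ)
    {Ω : Type*} [MeasurableSpace Ω] (μ : Measure Ω) (ℱ : Filtration ℕ ‹MeasurableSpace Ω›)
    (X : (k : ℕ) → Ω → Fin (R k) → Path n T) (p q : ℕ → Ω → Weights n) : Prop where
  /-- The initial point. -/
  init : ∀ ω, p 0 ω = p₁
  /-- The current solution is known when the iteration starts. -/
  measurable_p : ∀ k, Measurable[ℱ k] (p k)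
  /-- The sample paths of iteration `k` are known after iteration `k`. -/
  measurable_X : ∀ k, Measurable[ℱ (k + 1)] (X k)
  /-- The solution of the subproblem of iteration `k` is known after iteration `k`. -/
  measurable_q : ∀ k, Measurable[ℱ (k + 1)] (q k)
  /-- Step 1: given the past, the `R k` sample paths are i.i.d. replications under `p k`. -/
  sampling : ∀ k (x : Fin (R k) → Path n T),
    μ[({ω | X k ω = x}).indicator (fun _ => (1 : ℝ)) | ℱ k]
      =ᵐ[μ] fun ω => ∏ r, pathProb (p k ω) (x r)
  /-- Steps 2 and 3: `q k` minimizes `ψ̂(p_k)' (q - p_k)` over `q ∈ U`. -/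
  subproblem : ∀ k ω,
    IsMinimizer (fun q' => pairing (gradEst h (p k ω) (X k ω)) (q' - p k ω)) U (q k ω)
  /-- Step 4: the update. -/
  update : ∀ k ω, p (k + 1) ω = (1 - ε k) • p k ω + ε k • q k ω

end FWSA

/-!
On the product of simplices the influence-function pairing `ψ(p)'(q - p)` is the directional
derivative of the polynomial `Z` (`pairing_grad`), so `Z` satisfies a second-order descent inequality
along each Frank–Wolfe step. Comparing the estimated subproblem with the exact one
(`pairing_le_of_isMinimizer`) gives
`Z(p_{k+1}) ≤ Z(p_k) - ε_k g(p_k) + 2 ε_k |ψ̂(p_k) - ψ(p_k)|₁ + K ε_k²`.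

The only probabilistic input is that `∑ ε_k |ψ̂(p_k) - ψ(p_k)|₁` is almost surely finite
(`IsRun.ae_summable_noise`), which follows from the finiteness of its expectation: the score-function
estimator is unbiased (`grad_eq_sum_score`) with variance of order `1 / (R_k p^i_{k,j})`
(`mean_abs_gradEst_sub_le`), and `p^i_{k,j} ≥ a_k p^i_{1,j}`, where `a_k = ∏_{j<k} (1 - ε_j)` is the
weight that the initial point retains in `p_k`. The assumption on the sample sizes is then exactly
summability of the bound; no martingale convergence theorem is needed.

The rest is pathwise. The iterates need not be feasible, but `p_k = a_k p_1 + (1 - a_k) u_k` with `u_k`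
feasible, so `g(p_k) ≥ -C a_k`, and `∑ ε_k a_k` telescopes. Hence `Z(p_k)` decreases by
`ε_k (g(p_k) + C a_k) ≥ 0` up to summable errors; it converges, and since `∑ ε_k = ∞` the decrement
is frequently arbitrarily small (`tendsto_and_frequently_lt`). By compactness a subsequence of `p_k`
converges to a feasible zero `w` of the gap, so `Z(p_k) → Z(w)`
(`IsRun.exists_gap_eq_zero_and_tendsto`). If `w` is the unique minimizer, every cluster point of the
iterates has the minimal value and therefore equals `w` (`IsRun.tendsto_of_tendsto_perf`).
-/

namespace FWSA

variable {m : ℕ} {n T : Fin m → ℕ}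

/-! ### Calculus of the performance measure -/

lemma contDiff_perf (h : Path n T → ℝ) {N : WithTop ℕ∞} : ContDiff ℝ N (perf h) := by
  unfold perf pathProb
  refine ContDiff.sum fun x _ => contDiff_const.mul ?_
  refine contDiff_prod fun i _ => contDiff_prod fun t _ => ?_
  exact contDiff_pi.1 (contDiff_pi.1 contDiff_id i) (x i t)

lemma differentiable_perf (h : Path n T → ℝ) : Differentiable ℝ (perf h) :=
  (contDiff_perf h (N := 1)).differentiable one_ne_zero

/-- Moving the `i`-th block of `p` towards the `j`-th vertex is a straight line in weight space. -/
lemma update_eq_add_smul (p : Weights n) (i : Fin m) (j : Fin (n i)) (e : ℝ) :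
    Function.update p i ((1 - e) • p i + e • Pi.single j (1 : ℝ))
      = p + e • (Pi.single i (Pi.single j (1 : ℝ) - p i) : Weights n) := by
  funext i'
  by_cases hi : i' = i
  · subst hi
    simp only [Function.update_self, Pi.add_apply, Pi.smul_apply, Pi.single_eq_same]
    module
  · simp [hi]

lemma grad_eq_fderiv (h : Path n T → ℝ) (p : Weights n) (i : Fin m) (j : Fin (n i)) :
    grad h p i j = fderiv ℝ (perf h) p (Pi.single i (Pi.single j (1 : ℝ) - p i)) := by
  unfold grad
  simp_rw [update_eq_add_smul]
  have h1 : HasDerivAt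
      (fun e : ℝ => p + e • (Pi.single i (Pi.single j (1 : ℝ) - p i) : Weights n))
      (Pi.single i (Pi.single j (1 : ℝ) - p i)) 0 := by
    simpa using ((hasDerivAt_id (0 : ℝ)).smul_const
      (Pi.single i (Pi.single j (1 : ℝ) - p i) : Weights n)).const_add p
  have h2 : HasFDerivAt (perf h) (fderiv ℝ (perf h) p)
      (p + (0 : ℝ) • (Pi.single i (Pi.single j (1 : ℝ) - p i) : Weights n)) := by
    simpa using (differentiable_perf h p).hasFDerivAt
  exact ((h2.comp_hasDerivAt (0 : ℝ) h1).hasDerivWithinAt).derivWithin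
    (uniqueDiffOn_Icc zero_lt_one 0 (by simp))

lemma mem_simplices {p : Weights n} :
    p ∈ simplices n ↔ ∀ i, (∀ j, 0 ≤ p i j) ∧ ∑ j, p i j = 1 := by
  simp [simplices, stdSimplex]

lemma isCompact_simplices : IsCompact (simplices n) :=
  isCompact_univ_pi fun _ => isCompact_stdSimplex _ _

lemma convex_simplices : Convex ℝ (simplices n) :=
  convex_pi fun _ _ => convex_stdSimplex _ _

lemma le_one_of_mem_simplices {p : Weights n} (hp : p ∈ simplices n) (i : Fin m) (j : Fin (n i)) :
    p i j ≤ 1 := by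
  obtain ⟨h0, h1⟩ := mem_simplices.1 hp i
  rw [← h1]
  exact Finset.single_le_sum (fun j _ => h0 j) (Finset.mem_univ j)

/-- Between weight vectors the influence-function pairing `ψ(p)'(q - p)` is the directional
derivative of `Z`: the centring term of `ψ` is constant on each block and `q - p` has block sums
`0`. -/
lemma pairing_grad (h : Path n T → ℝ) {p q : Weights n} (hp : p ∈ simplices n)
    (hq : q ∈ simplices n) :
    pairing (grad h p) (q - p) = fderiv ℝ (perf h) p (q - p) := by
  have key : ∑ i, ∑ j, (q - p) i j •
      (Pi.single i (Pi.single j (1 : ℝ) - p i) : Weights n) = q - p := by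
    funext i' j'
    simp only [Finset.sum_apply, Pi.smul_apply, smul_eq_mul]
    rw [Finset.sum_eq_single i' (fun i _ hi => by simp [Pi.single_eq_of_ne hi.symm]) (by simp)]
    have hs : ∑ j, (q - p) i' j = 0 := by
      simp [(mem_simplices.1 hp i').2, (mem_simplices.1 hq i').2]
    simp only [Pi.single_eq_same, Pi.sub_apply, mul_sub, Finset.sum_sub_distrib]
    rw [Pi.sub_def] at hs
    simp only [Pi.sub_apply] at hs
    rw [← Finset.sum_mul, hs, Finset.sum_eq_single j' (fun j _ hj => by
      simp [Pi.single_eq_of_ne hj.symm]) (by simp)]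
    simp
  rw [pairing]
  conv_rhs => rw [← key]
  simp only [map_sum, map_smul, smul_eq_mul, grad_eq_fderiv]
  exact Finset.sum_congr rfl fun i _ => Finset.sum_congr rfl fun j _ => mul_comm _ _

lemma continuous_fderiv_perf (h : Path n T → ℝ) : Continuous (fderiv ℝ (perf h)) :=
  (contDiff_perf h (N := 1)).continuous_fderiv one_ne_zero

lemma continuous_grad (h : Path n T → ℝ) : Continuous (grad h) := by
  refine continuous_pi fun i => continuous_pi fun j => ?_
  simp_rw [grad_eq_fderiv]
  refine (continuous_fderiv_perf h).clm_apply ?_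
  exact (continuous_single i).comp (continuous_const.sub (continuous_apply i))

lemma continuous_pairing : Continuous fun v : Weights n × Weights n => pairing v.1 v.2 := by
  unfold pairing
  fun_prop

/-- Second-order upper bound for `Z` along segments of the product of simplices. -/
lemma exists_descent_constant (h : Path n T → ℝ) :
    ∃ K : ℝ, ∀ p ∈ simplices n, ∀ q ∈ simplices n, ∀ e ∈ Set.Icc (0 : ℝ) 1,
      perf h ((1 - e) • p + e • q)
        ≤ perf h p + e * pairing (grad h p) (q - p) + K * e ^ 2 := by
  have hc : ContDiff ℝ 1 (fderiv ℝ (perf h)) :=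
    (contDiff_perf h (N := 2)).fderiv_right (by norm_num)
  obtain ⟨L, hL⟩ := isCompact_simplices.exists_bound_of_continuousOn
    (hc.continuous_fderiv one_ne_zero).continuousOn (s := simplices n)
  obtain ⟨D, hD⟩ := isCompact_simplices.exists_bound_of_continuousOn
    (continuous_id).continuousOn (s := simplices n)
  refine ⟨|L| * (D + D) ^ 2, fun p hp q hq e he => ?_⟩
  set y := (1 - e) • p + e • q with hy
  have hyp : y - p = e • (q - p) := by rw [hy]; module
  have hys : y ∈ simplices n := convex_simplices hp hq (by linarith [he.2]) he.1 (by ring)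
  have hseg : segment ℝ p y ⊆ simplices n := convex_simplices.segment_subset hp hys
  have hlip : ∀ x ∈ segment ℝ p y, ‖fderiv ℝ (perf h) x - fderiv ℝ (perf h) p‖
      ≤ |L| * ‖y - p‖ := by
    intro x hx
    refine (convex_simplices.norm_image_sub_le_of_norm_fderiv_le (𝕜 := ℝ)
      (fun z _ => hc.differentiable one_ne_zero z)
      (fun z hz => (hL z hz).trans (le_abs_self L)) hp (hseg hx)).trans ?_
    gcongr
    exact norm_sub_le_of_mem_segment hx
  have hmv := (convex_segment p y).norm_image_sub_le_of_norm_hasFDerivWithin_le'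
    (𝕜 := ℝ) (f := perf h) (φ := fderiv ℝ (perf h) p)
    (fun x _ => (differentiable_perf h x).hasFDerivAt.hasFDerivWithinAt) hlip
    (left_mem_segment ℝ p y) (right_mem_segment ℝ p y)
  have hqp : ‖q - p‖ ≤ D + D := (norm_sub_le q p).trans (add_le_add (hD q hq) (hD p hp))
  have hn : ‖y - p‖ = e * ‖q - p‖ := by
    rw [hyp, norm_smul, Real.norm_of_nonneg he.1]
  rw [hn, Real.norm_eq_abs] at hmv
  rw [hyp, map_smul, smul_eq_mul, ← pairing_grad h hp hq] at hmv
  have h1 := (abs_le.1 hmv).2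
  have h2 : |L| * (e * ‖q - p‖) * (e * ‖q - p‖) ≤ |L| * (D + D) ^ 2 * e ^ 2 := by
    have : ‖q - p‖ ^ 2 ≤ (D + D) ^ 2 := by gcongr
    calc _ = |L| * ‖q - p‖ ^ 2 * e ^ 2 := by ring
      _ ≤ _ := by gcongr
  linarith

/-! ### Moments of the score-function estimator -/

/-- Under independence, an expectation of a product of functions of the single coordinates is the
product of the expectations. -/
lemma sum_prod_mul_prod {ι : Type*} {α : ι → Type*} [Fintype ι] [DecidableEq ι]
    [∀ i, Fintype (α i)] (w f : (i : ι) → α i → ℝ) :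
    ∑ x : (i : ι) → α i, (∏ i, w i (x i)) * ∏ i, f i (x i) = ∏ i, ∑ a, w i a * f i a := by
  rw [Finset.prod_univ_sum]
  simp [Finset.prod_mul_distrib]

lemma sum_prod_eq_one {ι : Type*} {α : ι → Type*} [Fintype ι] [DecidableEq ι]
    [∀ i, Fintype (α i)] {w : (i : ι) → α i → ℝ} (hw : ∀ i, ∑ a, w i a = 1) :
    ∑ x : (i : ι) → α i, ∏ i, w i (x i) = 1 := by
  simpa [hw] using sum_prod_mul_prod w fun _ _ => 1

/-- Marginals of a product distribution. -/
lemma sum_prod_mul_apply {ι : Type*} {α : ι → Type*} [Fintype ι] [DecidableEq ι]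
    [∀ i, Fintype (α i)] {w : (i : ι) → α i → ℝ} (hw : ∀ i, ∑ a, w i a = 1) (i₀ : ι)
    (f : α i₀ → ℝ) :
    ∑ x : (i : ι) → α i, (∏ i, w i (x i)) * f (x i₀) = ∑ a, w i₀ a * f a := by
  have h1 := sum_prod_mul_prod w fun i a => if hi : i = i₀ then f (hi ▸ a) else 1
  have h2 : ∀ x : (i : ι) → α i,
      ∏ i, (if hi : i = i₀ then f (hi ▸ x i) else 1) = f (x i₀) := fun x => by
    rw [Finset.prod_eq_single i₀ (fun i _ hi => by simp [hi]) (by simp)]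
    simp
  simp_rw [h2] at h1
  rw [h1, Finset.prod_eq_single i₀ (fun i _ hi => by simp [hi, hw]) (by simp)]
  simp

/-- The second moment of a sum of independent centred copies is the sum of second moments. -/
lemma sum_prod_mul_sq_sum {α : Type*} [Fintype α] {w f : α → ℝ} (hw : ∑ a, w a = 1)
    (hf : ∑ a, w a * f a = 0) (N : ℕ) :
    ∑ x : Fin N → α, (∏ r, w (x r)) * (∑ r, f (x r)) ^ 2 = N * ∑ a, w a * f a ^ 2 := by
  have hrs : ∀ r s : Fin N, ∑ x : Fin N → α, (∏ r, w (x r)) * (f (x r) * f (x s))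
      = if r = s then ∑ a, w a * f a ^ 2 else 0 := by
    intro r s
    split_ifs with h
    · subst h
      rw [← sum_prod_mul_apply (w := fun (_ : Fin N) a => w a) (fun _ => hw) r fun a => f a ^ 2]
      simp [sq]
    · have h1 := sum_prod_mul_prod (fun (_ : Fin N) a => w a)
        fun i a => (if i = r then f a else 1) * (if i = s then f a else 1)
      have h2 : ∀ x : Fin N → α, ∏ i, ((if i = r then f (x i) else 1) *
          (if i = s then f (x i) else 1)) = f (x r) * f (x s) := fun x => by
        rw [Finset.prod_mul_distrib]; simp
      simp_rw [h2] at h1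
      rw [h1]
      refine Finset.prod_eq_zero (Finset.mem_univ r) ?_
      simpa [h] using hf
  simp_rw [sq (∑ r, f _), Finset.sum_mul_sum, Finset.mul_sum]
  rw [Finset.sum_comm]
  simp_rw [Finset.sum_comm (s := (Finset.univ : Finset (Fin N → α))), hrs]
  simp [← Finset.mul_sum]

lemma pathProb_nonneg {p : Weights n} (hp : p ∈ simplices n) (x : Path n T) : 0 ≤ pathProb p x :=
  Finset.prod_nonneg fun i _ => Finset.prod_nonneg fun _ _ => (mem_simplices.1 hp i).1 _

lemma sum_pathProb {p : Weights n} (hp : p ∈ simplices n) :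
    ∑ x : Path n T, pathProb p x = 1 :=
  sum_prod_eq_one (w := fun i (y : Fin (T i) → Fin (n i)) => ∏ t, p i (y t)) fun i =>
    sum_prod_eq_one (w := fun _ a => p i a) fun _ => (mem_simplices.1 hp i).2

lemma sum_pathProb_mul_apply {p : Weights n} (hp : p ∈ simplices n) (i : Fin m) (t : Fin (T i))
    (f : Fin (n i) → ℝ) :
    ∑ x : Path n T, pathProb p x * f (x i t) = ∑ a, p i a * f a := by
  have h1 : ∀ i, ∑ y : Fin (T i) → Fin (n i), ∏ t, p i (y t) = 1 := fun i =>
    sum_prod_eq_one (w := fun _ a => p i a) fun _ => (mem_simplices.1 hp i).2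
  rw [← sum_prod_mul_apply (w := fun (_ : Fin (T i)) a => p i a)
    (fun _ => (mem_simplices.1 hp i).2) t f]
  exact sum_prod_mul_apply (w := fun i (y : Fin (T i) → Fin (n i)) => ∏ t, p i (y t)) h1 i
    fun y => f (y t)

lemma score_eq_sum (p : Weights n) (x : Path n T) (i : Fin m) (j : Fin (n i)) :
    score p x i j = ∑ t, ((if x i t = j then (1 : ℝ) else 0) / p i j - 1) := by
  simp [score]

/-- The score-function identity `ψ(p) = E_p[h(X) s(X)]`: the estimator is unbiased. -/
lemma grad_eq_sum_score (h : Path n T → ℝ) {p : Weights n} (hpos : ∀ i j, 0 < p i j)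
    (i : Fin m) (j : Fin (n i)) :
    grad h p i j = ∑ x, pathProb p x * (h x * score p x i j) := by
  have hx : ∀ x : Path n T, HasDerivAt (fun e : ℝ =>
      pathProb (Function.update p i ((1 - e) • p i + e • Pi.single j (1 : ℝ))) x)
      (pathProb p x * score p x i j) 0 := by
    intro x
    have hsplit : ∀ e : ℝ,
        pathProb (Function.update p i ((1 - e) • p i + e • Pi.single j (1 : ℝ))) x
          = (∏ t, ((1 - e) * p i (x i t) + e * if x i t = j then (1 : ℝ) else 0))
            * ∏ i' ∈ Finset.univ.erase i, ∏ t, p i' (x i' t) := by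
      intro e
      rw [pathProb, ← Finset.mul_prod_erase _ _ (Finset.mem_univ i)]
      congr 1
      · simp [Pi.single_apply]
      · refine Finset.prod_congr rfl fun i' hi' => ?_
        simp [Finset.ne_of_mem_erase hi']
    simp_rw [hsplit]
    have hfac : ∀ t, HasDerivAt
        (fun e : ℝ => (1 - e) * p i (x i t) + e * if x i t = j then (1 : ℝ) else 0)
        (p i (x i t) * ((if x i t = j then (1 : ℝ) else 0) / p i j - 1)) 0 := by
      intro t
      have h1 := (((hasDerivAt_id (0 : ℝ)).const_sub 1).mul_const (p i (x i t))).fun_add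
        ((hasDerivAt_id (0 : ℝ)).mul_const (if x i t = j then (1 : ℝ) else 0))
      refine h1.congr_deriv ?_
      have := (hpos i (x i t)).ne'
      by_cases hj : x i t = j
      · subst hj
        simp
        field_simp
        ring
      · simp [hj]
    have hprod := (HasDerivAt.fun_finsetProd (u := Finset.univ) fun t _ => hfac t).mul_const
      (∏ i' ∈ Finset.univ.erase i, ∏ t, p i' (x i' t))
    refine hprod.congr_deriv ?_
    rw [score_eq_sum, pathProb, ← Finset.mul_prod_erase _ _ (Finset.mem_univ i), mul_right_comm,
      Finset.mul_sum]
    congr 1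
    refine Finset.sum_congr rfl fun t ht => ?_
    rw [← Finset.mul_prod_erase _ _ ht]
    simp
    ring
  have hsum := HasDerivAt.fun_sum (u := (Finset.univ : Finset (Path n T)))
    fun x _ => (hx x).const_mul (h x)
  rw [grad]
  unfold perf
  rw [hsum.hasDerivWithinAt.derivWithin (uniqueDiffOn_Icc zero_lt_one 0 (by simp))]
  exact Finset.sum_congr rfl fun x _ => by ring

lemma sum_pathProb_mul_score_sq_le {p : Weights n} (hp : p ∈ simplices n)
    (hpos : ∀ i j, 0 < p i j) (i : Fin m) (j : Fin (n i)) :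
    ∑ x : Path n T, pathProb p x * score p x i j ^ 2 ≤ (T i : ℝ) ^ 2 / p i j := by
  have hj := hpos i j
  set s : Fin (n i) → ℝ := fun a => ((if a = j then (1 : ℝ) else 0) / p i j - 1) ^ 2 with hs
  have hone : ∑ a, p i a * s a ≤ 1 / p i j := by
    have h1 : ∀ a, p i a * s a
        = p i a * (if a = j then 1 / p i j ^ 2 - 2 / p i j else 0) + p i a := by
      intro a
      simp only [hs]
      split_ifs with h <;> ring
    simp_rw [h1]
    rw [Finset.sum_add_distrib, (mem_simplices.1 hp i).2]
    simp only [mul_ite, mul_zero, Finset.sum_ite_eq', Finset.mem_univ, if_true]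
    have : p i j * (1 / p i j ^ 2 - 2 / p i j) = 1 / p i j - 2 := by field_simp
    linarith
  calc ∑ x : Path n T, pathProb p x * score p x i j ^ 2
      ≤ ∑ x : Path n T, pathProb p x * (T i * ∑ t, s (x i t)) := by
        gcongr with x _
        · exact pathProb_nonneg hp x
        · rw [score_eq_sum]
          simpa using sq_sum_le_card_mul_sum_sq (s := (Finset.univ : Finset (Fin (T i))))
            (f := fun t => (if x i t = j then (1 : ℝ) else 0) / p i j - 1)
    _ = T i * ∑ t : Fin (T i), ∑ a, p i a * s a := by
        rw [← Finset.sum_congr rfl fun t _ => sum_pathProb_mul_apply hp i t s, Finset.sum_comm,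
          Finset.mul_sum]
        exact Finset.sum_congr rfl fun x _ => by rw [← Finset.mul_sum]; ring
    _ ≤ T i * ∑ t : Fin (T i), 1 / p i j := by gcongr
    _ = (T i : ℝ) ^ 2 / p i j := by simp; ring

/-- Mean absolute error of the estimator from `N` replications: by the Cauchy–Schwarz inequality it
is at most the standard deviation, which is of order `(N p^i_j)^{-1/2}`. -/
lemma mean_abs_gradEst_sub_le {h : Path n T → ℝ} {H : ℝ} (hH : ∀ x, |h x| ≤ H)
    {p : Weights n} (hp : p ∈ simplices n) (hpos : ∀ i j, 0 < p i j) {N : ℕ} (hN : 0 < N)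
    (i : Fin m) (j : Fin (n i)) :
    ∑ x : Fin N → Path n T, (∏ r, pathProb p (x r)) * |gradEst h p x i j - grad h p i j|
      ≤ H * T i / (Real.sqrt N * Real.sqrt (p i j)) := by
  have hN' : (0 : ℝ) < N := by exact_mod_cast hN
  have hj := hpos i j
  have hne : Nonempty (Path n T) := by
    by_contra hc
    rw [not_nonempty_iff] at hc
    simpa using sum_pathProb (T := T) hp
  have hH0 : 0 ≤ H := (abs_nonneg _).trans (hH hne.some)
  set f : Path n T → ℝ := fun x => h x * score p x i j - grad h p i j with hf
  have hf0 : ∑ x, pathProb p x * f x = 0 := by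
    simp only [hf, mul_sub, Finset.sum_sub_distrib, ← Finset.sum_mul, sum_pathProb hp]
    rw [grad_eq_sum_score h hpos]
    simp
  -- the variance is at most the second moment
  have hvar : ∑ x, pathProb p x * f x ^ 2 ≤ H ^ 2 * ((T i : ℝ) ^ 2 / p i j) := by
    have h1 : ∑ x, pathProb p x * f x ^ 2
        = ∑ x, pathProb p x * (h x * score p x i j) ^ 2 - grad h p i j ^ 2 := by
      have h2 : ∀ x, pathProb p x * f x ^ 2 = pathProb p x * (h x * score p x i j) ^ 2
          - 2 * grad h p i j * (pathProb p x * (h x * score p x i j))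
          + grad h p i j ^ 2 * pathProb p x := fun x => by simp only [hf]; ring
      simp_rw [h2]
      rw [Finset.sum_add_distrib, Finset.sum_sub_distrib, ← Finset.mul_sum, ← Finset.mul_sum,
        sum_pathProb hp, ← grad_eq_sum_score h hpos]
      ring
    calc _ ≤ ∑ x, pathProb p x * (h x * score p x i j) ^ 2 := by
          rw [h1]; linarith [sq_nonneg (grad h p i j)]
      _ ≤ ∑ x, H ^ 2 * (pathProb p x * score p x i j ^ 2) := by
          refine Finset.sum_le_sum fun x _ => ?_
          have h3 : h x ^ 2 ≤ H ^ 2 := sq_le_sq' (abs_le.1 (hH x)).1 (abs_le.1 (hH x)).2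
          have h4 : 0 ≤ pathProb p x * score p x i j ^ 2 :=
            mul_nonneg (pathProb_nonneg hp x) (sq_nonneg _)
          calc _ = h x ^ 2 * (pathProb p x * score p x i j ^ 2) := by ring
            _ ≤ _ := by gcongr
      _ ≤ _ := by
          rw [← Finset.mul_sum]
          gcongr
          exact sum_pathProb_mul_score_sq_le hp hpos i j
  have hest : ∀ x : Fin N → Path n T,
      gradEst h p x i j - grad h p i j = (∑ r, f (x r)) / N := by
    intro x
    simp only [gradEst, hf, Finset.sum_sub_distrib, Finset.sum_const, Finset.card_univ,
      Fintype.card_fin, nsmul_eq_mul]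
    field_simp
  have hW : ∀ x : Fin N → Path n T, 0 ≤ ∏ r, pathProb p (x r) := fun x =>
    Finset.prod_nonneg fun r _ => pathProb_nonneg hp _
  have hsq : (∑ x : Fin N → Path n T,
      (∏ r, pathProb p (x r)) * |gradEst h p x i j - grad h p i j|) ^ 2
      ≤ H ^ 2 * ((T i : ℝ) ^ 2 / p i j) / N := by
    have hcs := Finset.sum_sq_le_sum_mul_sum_of_sq_le_mul Finset.univ
      (r := fun x : Fin N → Path n T =>
        (∏ r, pathProb p (x r)) * |gradEst h p x i j - grad h p i j|)
      (f := fun x => ∏ r, pathProb p (x r))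
      (g := fun x => (∏ r, pathProb p (x r)) * (gradEst h p x i j - grad h p i j) ^ 2)
      (fun x _ => hW x) (fun x _ => mul_nonneg (hW x) (sq_nonneg _))
      (fun x _ => by rw [mul_pow, sq_abs]; exact le_of_eq (by ring))
    refine hcs.trans ?_
    rw [sum_prod_eq_one (w := fun (_ : Fin N) a => pathProb p a) (fun _ => sum_pathProb hp),
      one_mul]
    simp_rw [hest, div_pow, ← mul_div_assoc]
    rw [← Finset.sum_div, sum_prod_mul_sq_sum (sum_pathProb hp) hf0 N,
      div_le_div_iff₀ (by positivity) hN']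
    calc _ = (N : ℝ) ^ 2 * ∑ x, pathProb p x * f x ^ 2 := by ring
      _ ≤ (N : ℝ) ^ 2 * (H ^ 2 * ((T i : ℝ) ^ 2 / p i j)) := by gcongr
      _ = _ := by ring
  refine (abs_le_of_sq_le_sq' (hsq.trans (le_of_eq ?_)) (by positivity)).2
  rw [div_pow, mul_pow, mul_pow, Real.sq_sqrt hN'.le, Real.sq_sqrt hj.le]
  field_simp

/-! ### The weight of the initial point -/

/-- The coefficient of the initial point in the iterate `p k`, viewed as a convex combination of the
initial point and of solutions of subproblems. -/
noncomputable def initWeight (ε : ℕ → ℝ) (k : ℕ) : ℝ := ∏ j ∈ Finset.range k, (1 - ε j)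

section InitWeight

variable {ε : ℕ → ℝ} (h0 : ∀ k, 0 ≤ ε k) (h1 : ∀ k, ε k < 1)

lemma initWeight_succ (k : ℕ) : initWeight ε (k + 1) = (1 - ε k) * initWeight ε k := by
  rw [initWeight, Finset.prod_range_succ, mul_comm, initWeight]

include h1 in
lemma initWeight_pos (k : ℕ) : 0 < initWeight ε k :=
  Finset.prod_pos fun j _ => sub_pos.2 (h1 j)

include h0 h1 in
lemma initWeight_le_one (k : ℕ) : initWeight ε k ≤ 1 :=
  Finset.prod_le_one (fun j _ => (sub_pos.2 (h1 j)).le) fun j _ => by linarith [h0 j]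

include h1 in
lemma tendsto_initWeight (hsum : Tendsto (fun N => ∑ k ∈ Finset.range N, ε k) atTop atTop) :
    Tendsto (initWeight ε) atTop (𝓝 0) := by
  refine squeeze_zero (g := fun N => Real.exp (-∑ k ∈ Finset.range N, ε k))
    (fun k => (initWeight_pos h1 k).le) (fun k => ?_)
    (Real.tendsto_exp_neg_atTop_nhds_zero.comp hsum)
  rw [← Finset.sum_neg_distrib, Real.exp_sum]
  exact Finset.prod_le_prod (fun j _ => (sub_pos.2 (h1 j)).le) fun j _ =>
    Real.one_sub_le_exp_neg (ε j)

include h0 h1 in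
lemma summable_mul_initWeight : Summable fun k => ε k * initWeight ε k := by
  refine summable_of_sum_range_le (c := 1)
    (fun k => mul_nonneg (h0 k) (initWeight_pos h1 k).le) fun N => ?_
  have : ∑ k ∈ Finset.range N, ε k * initWeight ε k = 1 - initWeight ε N := by
    have ht := Finset.sum_range_sub' (initWeight ε) N
    rw [show initWeight ε 0 = 1 by simp [initWeight]] at ht
    rw [← ht]
    exact Finset.sum_congr rfl fun k _ => by rw [initWeight_succ]; ring
  linarith [initWeight_pos h1 N]

end InitWeight

/-! ### Runs of the algorithm -/

section Run

variable {h : Path n T → ℝ} {U : Set (Weights n)} {p₁ : Weights n} {ε : ℕ → ℝ} {R : ℕ → ℕ}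
  {Ω : Type*} [MeasurableSpace Ω] {μ : Measure Ω} {ℱ : Filtration ℕ ‹MeasurableSpace Ω›}
  {X : (k : ℕ) → Ω → Fin (R k) → Path n T} {p q : ℕ → Ω → Weights n}

lemma IsRun.mem_simplices (hrun : IsRun h U p₁ ε R μ ℱ X p q) (h0 : ∀ k, 0 ≤ ε k)
    (h1 : ∀ k, ε k < 1) (hU : U ⊆ simplices n) (hp₁ : p₁ ∈ simplices n) (k : ℕ) (ω : Ω) :
    p k ω ∈ simplices n := by
  induction k with
  | zero => rwa [hrun.init]
  | succ k ih =>
    rw [hrun.update]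
    exact convex_simplices ih (hU (hrun.subproblem k ω).1) (by linarith [h1 k]) (h0 k) (by ring)

lemma IsRun.initWeight_mul_le (hrun : IsRun h U p₁ ε R μ ℱ X p q) (h0 : ∀ k, 0 ≤ ε k)
    (h1 : ∀ k, ε k < 1) (hU : U ⊆ simplices n) (k : ℕ) (ω : Ω)
    (i : Fin m) (j : Fin (n i)) : initWeight ε k * p₁ i j ≤ p k ω i j := by
  induction k with
  | zero => simp [hrun.init, initWeight]
  | succ k ih =>
    have hq : 0 ≤ q k ω i j := (FWSA.mem_simplices.1 (hU (hrun.subproblem k ω).1) i).1 j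
    have := mul_le_mul_of_nonneg_left ih (sub_pos.2 (h1 k)).le
    rw [hrun.update, initWeight_succ]
    simp only [Pi.add_apply, Pi.smul_apply, smul_eq_mul]
    linarith [mul_nonneg (h0 k) hq]

open scoped Pointwise in
/-- Up to the contribution of the initial point, iterates lie in the feasible set. -/
lemma IsRun.exists_eq_add (hrun : IsRun h U p₁ ε R μ ℱ X p q) (h0 : ∀ k, 0 ≤ ε k)
    (h1 : ∀ k, ε k < 1) (hU : Convex ℝ U) (k : ℕ) (ω : Ω) :
    ∃ u ∈ U, p k ω = initWeight ε k • p₁ + (1 - initWeight ε k) • u := by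
  induction k with
  | zero => exact ⟨q 0 ω, (hrun.subproblem 0 ω).1, by simp [hrun.init, initWeight]⟩
  | succ k ih =>
    obtain ⟨u, hu, hpu⟩ := ih
    have ha := initWeight_le_one h0 h1 k
    have hmem : ((1 - ε k) * (1 - initWeight ε k)) • u + ε k • q k ω
        ∈ ((1 - ε k) * (1 - initWeight ε k) + ε k) • U := by
      rw [hU.add_smul (mul_nonneg (sub_pos.2 (h1 k)).le (sub_nonneg.2 ha)) (h0 k)]
      exact Set.add_mem_add (Set.smul_mem_smul_set hu)
        (Set.smul_mem_smul_set (hrun.subproblem k ω).1)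
    obtain ⟨v, hv, hve⟩ := hmem
    refine ⟨v, hv, ?_⟩
    have hc : 1 - initWeight ε (k + 1) = (1 - ε k) * (1 - initWeight ε k) + ε k := by
      rw [initWeight_succ]; ring
    rw [hc, hrun.update, hpu, initWeight_succ]
    simp only at hve
    rw [hve]
    module

/-- Conditionally on the past the samples of iteration `k` are distributed according to the product
weights, so they can be integrated out. -/
lemma IsRun.integral_comp [IsProbabilityMeasure μ] (hrun : IsRun h U p₁ ε R μ ℱ X p q) (k : ℕ)
    {F : Weights n → (Fin (R k) → Path n T) → ℝ} (hFm : ∀ x, Measurable fun p => F p x)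
    (hFb : ∀ x, ∃ B, ∀ ω, |F (p k ω) x| ≤ B) :
    Integrable (fun ω => F (p k ω) (X k ω)) μ ∧
      ∫ ω, F (p k ω) (X k ω) ∂μ = ∫ ω, ∑ x, (∏ r, pathProb (p k ω) (x r)) * F (p k ω) x ∂μ := by
  have hXm : Measurable (X k) := (hrun.measurable_X k).mono (ℱ.le _) le_rfl
  set I : (Fin (R k) → Path n T) → Ω → ℝ :=
    fun x => ({ω | X k ω = x}).indicator fun _ => (1 : ℝ) with hI
  have hIint : ∀ x, Integrable (I x) μ := fun x =>
    (integrable_const (1 : ℝ)).indicator (hXm (measurableSet_singleton x))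
  have hFk : ∀ x, Measurable[ℱ k] fun ω => F (p k ω) x := fun x =>
    (hFm x).comp (hrun.measurable_p k)
  have hFI : ∀ x, Integrable ((fun ω => F (p k ω) x) * I x) μ := by
    intro x
    obtain ⟨B, hB⟩ := hFb x
    exact (hIint x).bdd_mul ((hFk x).mono (ℱ.le k) le_rfl).aestronglyMeasurable
      (Eventually.of_forall hB)
  have hdecomp : ∀ ω, F (p k ω) (X k ω) = ∑ x, ((fun ω => F (p k ω) x) * I x) ω := by
    intro ω
    rw [Finset.sum_eq_single (X k ω) (fun x _ hx => by simp [hI, hx.symm]) (by simp)]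
    simp [hI]
  have hce : ∀ x, μ[(fun ω => F (p k ω) x) * I x | ℱ k]
      =ᵐ[μ] fun ω => (∏ r, pathProb (p k ω) (x r)) * F (p k ω) x := by
    intro x
    filter_upwards [condExp_mul_of_stronglyMeasurable_left (hFk x).stronglyMeasurable (hFI x)
      (hIint x), hrun.sampling k x] with ω h2 h3
    rw [h2, Pi.mul_apply, h3, mul_comm]
  constructor
  · simp_rw [hdecomp]
    exact integrable_finsetSum _ fun x _ => hFI x
  · simp_rw [hdecomp]
    rw [integral_finsetSum _ fun x _ => hFI x, integral_finsetSum]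
    · exact Finset.sum_congr rfl fun x _ => by
        rw [← integral_condExp (ℱ.le k), integral_congr_ae (hce x)]
    · exact fun x _ => integrable_condExp.congr (hce x)

lemma measurable_gradEst (h : Path n T → ℝ) {N : ℕ} (x : Fin N → Path n T) :
    Measurable fun p => gradEst h p x := by
  refine measurable_pi_iff.2 fun i => measurable_pi_iff.2 fun j => ?_
  unfold gradEst score
  fun_prop

/-- The estimation error of one coordinate in iteration `k` is integrable, and its mean is bounded
through the lower bound for the coordinates of the iterates. -/
lemma IsRun.integral_abs_gradEst_sub_le [IsProbabilityMeasure μ]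
    (hrun : IsRun h U p₁ ε R μ ℱ X p q)
    (h0 : ∀ k, 0 ≤ ε k) (h1 : ∀ k, ε k < 1) (hU : U ⊆ simplices n) (hp₁ : p₁ ∈ simplices n)
    (hpos : ∀ i j, 0 < p₁ i j) (hR : ∀ k, 0 < R k) {H : ℝ} (hH0 : 0 ≤ H) (hH : ∀ x, |h x| ≤ H)
    (k : ℕ) (i : Fin m) (j : Fin (n i)) :
    Integrable (fun ω => |gradEst h (p k ω) (X k ω) i j - grad h (p k ω) i j|) μ ∧
      ∫ ω, |gradEst h (p k ω) (X k ω) i j - grad h (p k ω) i j| ∂μ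
        ≤ H * T i / (Real.sqrt (R k) * Real.sqrt (initWeight ε k * p₁ i j)) := by
  have hlow := hrun.initWeight_mul_le h0 h1 hU k
  have hmem := hrun.mem_simplices h0 h1 hU hp₁ k
  have ha := initWeight_pos h1 k
  have hpk : ∀ ω i j, 0 < p k ω i j := fun ω i j =>
    (mul_pos ha (hpos i j)).trans_le (hlow ω i j)
  -- on this compact set, which contains all values of `p k`, the score is continuous
  set K : Set (Weights n) := simplices n ∩ {w | ∀ i j, initWeight ε k * p₁ i j ≤ w i j} with hK
  have hKc : IsCompact K := by
    refine isCompact_simplices.inter_right ?_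
    simp only [Set.ofPred_forall]
    exact isClosed_iInter fun i => isClosed_iInter fun j =>
      isClosed_le continuous_const (by fun_prop)
  obtain ⟨hint, hval⟩ := hrun.integral_comp k
    (F := fun w x => |gradEst h w x i j - grad h w i j|)
    (fun x => by
      have hm1 : Measurable fun w => gradEst h w x i j :=
        measurable_pi_iff.1 (measurable_pi_iff.1 (measurable_gradEst h x) i) j
      have hm2 : Measurable fun w => grad h w i j :=
        measurable_pi_iff.1 (measurable_pi_iff.1 (continuous_grad h).measurable i) j
      exact (hm1.sub hm2).abs)
    (fun x => by
      have hc1 : ContinuousOn (fun w => gradEst h w x i j) K := by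
        have hne : ∀ w ∈ K, w i j ≠ 0 := fun w hw =>
          ((mul_pos ha (hpos i j)).trans_le (hw.2 i j)).ne'
        unfold gradEst score
        fun_prop (disch := assumption)
      have hc2 : Continuous fun w => grad h w i j := by
        have := continuous_grad h
        fun_prop
      obtain ⟨B, hB⟩ := hKc.exists_bound_of_continuousOn (hc1.sub hc2.continuousOn)
      exact ⟨B, fun ω => by simpa using hB (p k ω) ⟨hmem ω, hlow ω⟩⟩)
  refine ⟨hint, hval.trans_le ?_⟩
  set b := H * T i / (Real.sqrt (R k) * Real.sqrt (initWeight ε k * p₁ i j)) with hb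
  have hb0 : 0 ≤ b := by positivity
  have hRk : (0 : ℝ) < R k := by exact_mod_cast hR k
  have hbound : ∀ ω, ∑ x : Fin (R k) → Path n T, (∏ r, pathProb (p k ω) (x r)) *
      |gradEst h (p k ω) x i j - grad h (p k ω) i j| ≤ b := by
    intro ω
    refine (mean_abs_gradEst_sub_le hH (hmem ω) (hpk ω) (hR k) i j).trans ?_
    have h2 : 0 < Real.sqrt (initWeight ε k * p₁ i j) :=
      Real.sqrt_pos.2 (mul_pos ha (hpos i j))
    rw [hb]
    gcongr
    exact hlow ω i j
  have := integral_mono_of_nonneg (μ := μ) (g := fun _ => b)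
    (Eventually.of_forall fun ω => Finset.sum_nonneg fun x _ => mul_nonneg
      (Finset.prod_nonneg fun r _ => pathProb_nonneg (hmem ω) _) (abs_nonneg _))
    (integrable_const b) (Eventually.of_forall hbound)
  simpa using this

/-- Nonnegative integrable functions with summable integrals are almost everywhere summable. -/
lemma ae_summable_of_summable_integral {f : ℕ → Ω → ℝ} (hf0 : ∀ k ω, 0 ≤ f k ω)
    (hf : ∀ k, Integrable (f k) μ) (hs : Summable fun k => ∫ ω, f k ω ∂μ) :
    ∀ᵐ ω ∂μ, Summable fun k => f k ω := by
  have hm : ∀ k, AEMeasurable (fun ω => ENNReal.ofReal (f k ω)) μ := fun k =>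
    (hf k).aestronglyMeasurable.aemeasurable.ennreal_ofReal
  have hfin : ∫⁻ ω, ∑' k, ENNReal.ofReal (f k ω) ∂μ ≠ ⊤ := by
    rw [lintegral_tsum hm]
    have h2 : ∀ k, ∫⁻ ω, ENNReal.ofReal (f k ω) ∂μ = ENNReal.ofReal (∫ ω, f k ω ∂μ) := fun k =>
      (ofReal_integral_eq_lintegral_ofReal (hf k) (Eventually.of_forall (hf0 k))).symm
    simp_rw [h2]
    exact hs.tsum_ofReal_ne_top
  filter_upwards [ae_lt_top' (AEMeasurable.tsum hm) hfin] with ω hω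
  have := ENNReal.summable_toReal hω.ne
  simpa [ENNReal.toReal_ofReal (hf0 _ ω)] using this

/-- The total estimation error `∑_k ε_k |ψ̂(p_k) - ψ(p_k)|` is almost surely finite. -/
lemma IsRun.ae_summable_noise [IsProbabilityMeasure μ] (hrun : IsRun h U p₁ ε R μ ℱ X p q)
    (h0 : ∀ k, 0 ≤ ε k) (h1 : ∀ k, ε k < 1) (hU : U ⊆ simplices n) (hp₁ : p₁ ∈ simplices n)
    (hpos : ∀ i j, 0 < p₁ i j) (hR : ∀ k, 0 < R k)
    (hsum : Summable fun k =>
      ε k / Real.sqrt (R k) * ∏ j ∈ Finset.range k, (1 - ε j) ^ (-(1 / 2) : ℝ)) :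
    ∀ᵐ ω ∂μ, Summable fun k =>
      ε k * ∑ i, ∑ j, |gradEst h (p k ω) (X k ω) i j - grad h (p k ω) i j| := by
  set H : ℝ := ∑ x, |h x| with hHdef
  have hH0 : 0 ≤ H := Finset.sum_nonneg fun x _ => abs_nonneg _
  have hH : ∀ x, |h x| ≤ H := fun x =>
    Finset.single_le_sum (f := fun x => |h x|) (fun x _ => abs_nonneg _) (Finset.mem_univ x)
  have hcoord := hrun.integral_abs_gradEst_sub_le h0 h1 hU hp₁ hpos hR hH0 hH
  refine ae_summable_of_summable_integral
    (fun k ω => mul_nonneg (h0 k) (Finset.sum_nonneg fun i _ => Finset.sum_nonneg fun j _ =>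
      abs_nonneg _))
    (fun k => (integrable_finsetSum _ fun i _ => integrable_finsetSum _ fun j _ =>
      (hcoord k i j).1).const_mul _) ?_
  refine Summable.of_nonneg_of_le (fun k => integral_nonneg fun ω => mul_nonneg (h0 k)
    (Finset.sum_nonneg fun i _ => Finset.sum_nonneg fun j _ => abs_nonneg _)) (fun k => ?_)
    (hsum.mul_left (∑ i, ∑ j, H * T i / Real.sqrt (p₁ i j)))
  have hprod : ∏ j ∈ Finset.range k, (1 - ε j) ^ (-(1 / 2) : ℝ)
      = (Real.sqrt (initWeight ε k))⁻¹ := by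
    rw [Real.finsetProd_rpow _ _ fun j _ => (sub_pos.2 (h1 j)).le, ← initWeight,
      Real.rpow_neg (initWeight_pos h1 k).le, Real.sqrt_eq_rpow]
  rw [integral_const_mul, integral_finsetSum _ fun i _ => integrable_finsetSum _ fun j _ =>
      (hcoord k i j).1, hprod]
  calc ε k * ∑ i, ∫ ω, ∑ j, |gradEst h (p k ω) (X k ω) i j - grad h (p k ω) i j| ∂μ
      ≤ ε k * ∑ i, ∑ j,
          H * T i / (Real.sqrt (R k) * Real.sqrt (initWeight ε k * p₁ i j)) := by
        refine mul_le_mul_of_nonneg_left (Finset.sum_le_sum fun i _ => ?_) (h0 k)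
        rw [integral_finsetSum _ fun j _ => (hcoord k i j).1]
        exact Finset.sum_le_sum fun j _ => (hcoord k i j).2
    _ = (∑ i, ∑ j, H * T i / Real.sqrt (p₁ i j))
          * (ε k / Real.sqrt (R k) * (Real.sqrt (initWeight ε k))⁻¹) := by
        simp_rw [Finset.mul_sum, Finset.sum_mul, Real.sqrt_mul (initWeight_pos h1 k).le]
        exact Finset.sum_congr rfl fun i _ => Finset.sum_congr rfl fun j _ => by
          simp only [div_eq_mul_inv, mul_inv]; ring

end Run

/-! ### Descent up to summable errors -/

/-- If `z` decreases by `ε_k G_k` up to a summable error, with `G_k ≥ 0` and `∑ ε_k = ∞`, and `z` is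
bounded below, then `z` converges and `G` is frequently arbitrarily small. -/
lemma tendsto_and_frequently_lt {z G ε η : ℕ → ℝ} (hstep : ∀ k, z (k + 1) ≤ z k - ε k * G k + η k)
    (hG : ∀ k, 0 ≤ G k) (hε : ∀ k, 0 ≤ ε k)
    (hsum : Tendsto (fun N => ∑ k ∈ Finset.range N, ε k) atTop atTop) (hη : Summable η)
    {B : ℝ} (hz : ∀ k, B ≤ z k) :
    (∃ l, Tendsto z atTop (𝓝 l)) ∧ ∀ δ > 0, ∃ᶠ k in atTop, G k < δ := by
  have hηt := hη.hasSum.tendsto_sum_nat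
  obtain ⟨S, hS⟩ := hηt.bddAbove_range
  set y : ℕ → ℝ := fun k => z k - ∑ j ∈ Finset.range k, η j with hy
  have hystep : ∀ k, y (k + 1) ≤ y k - ε k * G k := fun k => by
    simp only [hy, Finset.sum_range_succ]
    linarith [hstep k]
  have hanti : Antitone y := antitone_nat_of_succ_le fun k =>
    (hystep k).trans (sub_le_self _ (mul_nonneg (hε k) (hG k)))
  have hyB : ∀ k, B - S ≤ y k := fun k => by
    have := hS (Set.mem_range_self k)
    simp only [hy]
    linarith [hz k]
  have hybdd : BddBelow (Set.range y) := ⟨B - S, by rintro _ ⟨k, rfl⟩; exact hyB k⟩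
  refine ⟨⟨_, ((tendsto_atTop_ciInf hanti hybdd).add hηt).congr fun k => by simp [hy]⟩, ?_⟩
  intro δ hδ hev
  rw [eventually_atTop] at hev
  obtain ⟨N, hN⟩ := hev
  -- from `N` on, `y` decreases by at least `δ ε_k`
  have hdec : ∀ k ≥ N, y k + δ * ∑ j ∈ Finset.range k, ε j
      ≤ y N + δ * ∑ j ∈ Finset.range N, ε j := by
    intro k hk
    induction k, hk using Nat.le_induction with
    | base => exact le_rfl
    | succ k hk ih =>
      rw [Finset.sum_range_succ]
      have := mul_le_mul_of_nonneg_left (not_lt.1 (hN k hk)) (hε k)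
      linarith [hystep k]
  obtain ⟨k, hkN, hk⟩ := ((eventually_ge_atTop N).and ((hsum.const_mul_atTop hδ).eventually_gt_atTop
    (y N + δ * ∑ j ∈ Finset.range N, ε j - (B - S)))).exists
  linarith [hdec k hkN, hyB k]

lemma abs_pairing_sub_le {p q : Weights n} (hp : p ∈ simplices n) (hq : q ∈ simplices n)
    (v : Weights n) : |pairing v (q - p)| ≤ ∑ i, ∑ j, |v i j| := by
  refine (Finset.abs_sum_le_sum_abs _ _).trans (Finset.sum_le_sum fun i _ => ?_)
  refine (Finset.abs_sum_le_sum_abs _ _).trans (Finset.sum_le_sum fun j _ => ?_)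
  rw [abs_mul]
  refine mul_le_of_le_one_right (abs_nonneg _) (abs_le.2 ⟨?_, ?_⟩)
  · simp only [Pi.sub_apply]
    linarith [(mem_simplices.1 hq i).1 j, le_one_of_mem_simplices hp i j]
  · simp only [Pi.sub_apply]
    linarith [(mem_simplices.1 hp i).1 j, le_one_of_mem_simplices hq i j]

lemma pairing_sub_left (v v' w : Weights n) :
    pairing (v - v') w = pairing v w - pairing v' w := by
  simp [pairing, sub_mul]

/-- Some point of the feasible set attains the minimum in the Frank–Wolfe gap. -/
lemma exists_gap_eq (h : Path n T → ℝ) {U : Set (Weights n)} (hU : IsCompact U)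
    (hne : U.Nonempty) (p : Weights n) :
    ∃ q ∈ U, gap h U p = - pairing (grad h p) (q - p) ∧
      ∀ q' ∈ U, - pairing (grad h p) (q' - p) ≤ gap h U p := by
  have hc : Continuous fun q => pairing (grad h p) (q - p) :=
    continuous_pairing.comp (continuous_const.prodMk (continuous_id.sub continuous_const))
  obtain ⟨q, hq, hmin⟩ := hU.exists_isMinOn hne hc.continuousOn
  have hl : IsLeast ((fun q => pairing (grad h p) (q - p)) '' U)
      (pairing (grad h p) (q - p)) :=
    ⟨⟨q, hq, rfl⟩, by rintro _ ⟨q', hq', rfl⟩; exact hmin hq'⟩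
  have hgap : gap h U p = - pairing (grad h p) (q - p) := by rw [gap, hl.csInf_eq]
  exact ⟨q, hq, hgap, fun q' hq' => by rw [hgap]; exact neg_le_neg (hmin hq')⟩

lemma pairing_zero_right (v : Weights n) : pairing v 0 = 0 := by simp [pairing]

/-- One inexact Frank–Wolfe step: replacing `ψ(p)` by an estimate `v` costs at most twice the error
of the estimate, once in the choice of `q` and once in the descent inequality. -/
lemma pairing_le_of_isMinimizer {h : Path n T → ℝ} {U : Set (Weights n)} (hU : U ⊆ simplices n)
    (hUc : IsCompact U) {p q v : Weights n} (hp : p ∈ simplices n)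
    (hq : IsMinimizer (fun q' => pairing v (q' - p)) U q) :
    pairing (grad h p) (q - p) ≤ - gap h U p + 2 * ∑ i, ∑ j, |v i j - grad h p i j| := by
  obtain ⟨s, hs, hgap, -⟩ := exists_gap_eq h hUc ⟨q, hq.1⟩ p
  have h1 := (abs_le.1 (abs_pairing_sub_le hp (hU hq.1) (v - grad h p))).1
  have h2 := (abs_le.1 (abs_pairing_sub_le hp (hU hs) (v - grad h p))).2
  rw [pairing_sub_left] at h1 h2
  have h3 := hq.2 s hs
  simp only [Pi.sub_apply] at h1 h2 h3
  linarith

/-! ### Pathwise convergence -/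

lemma pairing_smul_right (v w : Weights n) (c : ℝ) : pairing v (c • w) = c * pairing v w := by
  simp only [pairing, Pi.smul_apply, smul_eq_mul, Finset.mul_sum]
  exact Finset.sum_congr rfl fun i _ => Finset.sum_congr rfl fun j _ => by ring

section Pathwise

variable {h : Path n T → ℝ} {U : Set (Weights n)} {p₁ : Weights n} {ε : ℕ → ℝ} {R : ℕ → ℕ}
  {Ω : Type*} [MeasurableSpace Ω] {μ : Measure Ω} {ℱ : Filtration ℕ ‹MeasurableSpace Ω›}
  {X : (k : ℕ) → Ω → Fin (R k) → Path n T} {p q : ℕ → Ω → Weights n}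

/-- Along any subsequence, the feasible parts of the iterates carry the limit. -/
lemma tendsto_of_eq_initWeight_add {x u : ℕ → Weights n} {a : ℕ → ℝ}
    (hx : ∀ k, x k = a k • p₁ + (1 - a k) • u k) (ha : Tendsto a atTop (𝓝 0)) {w : Weights n}
    {φ : ℕ → ℕ} (hφ : Tendsto φ atTop atTop) (hu : Tendsto (u ∘ φ) atTop (𝓝 w)) :
    Tendsto (x ∘ φ) atTop (𝓝 w) := by
  have ha' := ha.comp hφ
  have := (ha'.smul_const p₁).add ((ha'.const_sub 1).smul hu)
  simp only [zero_smul, sub_zero, one_smul, zero_add] at this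
  exact this.congr fun k => (hx (φ k)).symm

/-- On a sample path with finite total estimation error, `Z(p_k)` converges to the value of `Z` at a
zero of the Frank–Wolfe gap. The gap may be negative at infeasible iterates, but at `p_k` it is at
least `-C a_k`, where `a_k` is the weight of the initial point, and `∑ ε_k a_k < ∞`; so
`g(p_k) + C a_k` can play the role of the nonnegative decrement. -/
lemma IsRun.exists_gap_eq_zero_and_tendsto (hrun : IsRun h U p₁ ε R μ ℱ X p q)
    (h0 : ∀ k, 0 ≤ ε k) (h1 : ∀ k, ε k < 1)
    (hsum : Tendsto (fun N => ∑ k ∈ Finset.range N, ε k) atTop atTop)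
    (hsq : Summable fun k => ε k ^ 2) (hU : U ⊆ simplices n) (hUconv : Convex ℝ U)
    (hUc : IsCompact U) (hp₁ : p₁ ∈ simplices n) {ω : Ω}
    (hω : Summable fun k =>
      ε k * ∑ i, ∑ j, |gradEst h (p k ω) (X k ω) i j - grad h (p k ω) i j|) :
    ∃ w ∈ U, gap h U w = 0 ∧ Tendsto (fun k => perf h (p k ω)) atTop (𝓝 (perf h w)) := by
  have hmem := fun k => hrun.mem_simplices h0 h1 hU hp₁ k ω
  have hne : U.Nonempty := ⟨_, (hrun.subproblem 0 ω).1⟩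
  choose u hu hpu using fun k => hrun.exists_eq_add h0 h1 hUconv k ω
  obtain ⟨K, hK⟩ := exists_descent_constant h
  have hgc : Continuous fun w : Weights n => ∑ i, ∑ j, |grad h w i j| := by
    have := continuous_grad h
    fun_prop
  obtain ⟨C, hC⟩ := isCompact_simplices.exists_bound_of_continuousOn hgc.continuousOn
  obtain ⟨B, hB⟩ := isCompact_simplices.exists_bound_of_continuousOn
    (contDiff_perf h (N := 0)).continuous.continuousOn
  set G : ℕ → ℝ := fun k => gap h U (p k ω) + C * initWeight ε k with hGdef
  have hG : ∀ k, 0 ≤ G k := by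
    intro k
    obtain ⟨-, -, -, hgap⟩ := exists_gap_eq h hUc hne (p k ω)
    have h2 := hgap _ (hu k)
    have h3 : u k - p k ω = initWeight ε k • (u k - p₁) := by rw [hpu k]; module
    rw [h3, pairing_smul_right] at h2
    have h4 : pairing (grad h (p k ω)) (u k - p₁) ≤ C :=
      ((le_abs_self _).trans (abs_pairing_sub_le hp₁ (hU (hu k)) _)).trans
        ((le_abs_self _).trans (hC _ (hmem k)))
    have := mul_le_mul_of_nonneg_left h4 (initWeight_pos h1 k).le
    simp only [hGdef]
    linarith
  have hstep : ∀ k, perf h (p (k + 1) ω) ≤ perf h (p k ω) - ε k * G k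
      + (C * (ε k * initWeight ε k)
        + 2 * (ε k * ∑ i, ∑ j, |gradEst h (p k ω) (X k ω) i j - grad h (p k ω) i j|)
        + K * ε k ^ 2) := by
    intro k
    have h2 := hK _ (hmem k) _ (hU (hrun.subproblem k ω).1) (ε k) ⟨h0 k, (h1 k).le⟩
    have h3 := mul_le_mul_of_nonneg_left
      (pairing_le_of_isMinimizer (h := h) hU hUc (hmem k) (hrun.subproblem k ω)) (h0 k)
    rw [← hrun.update] at h2
    simp only [hGdef]
    linarith
  obtain ⟨⟨l, hl⟩, hfreq⟩ := tendsto_and_frequently_lt (z := fun k => perf h (p k ω)) hstep hG h0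
    hsum ((((summable_mul_initWeight h0 h1).mul_left C).add (hω.mul_left 2)).add (hsq.mul_left K))
    (B := -B) fun k => (abs_le.1 (hB _ (hmem k))).1
  obtain ⟨φ, hφ, hGφ⟩ := extraction_forall_of_frequently
    fun N : ℕ => hfreq (1 / ((N : ℝ) + 1)) Nat.one_div_pos_of_nat
  obtain ⟨w, hw, ρ, hρ, hlim⟩ := hUc.tendsto_subseq fun N => hu (φ N)
  have hφρ : Tendsto (φ ∘ ρ) atTop atTop := (hφ.comp hρ).tendsto_atTop
  have hpw := tendsto_of_eq_initWeight_add hpu (tendsto_initWeight h1 hsum) hφρ hlim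
  refine ⟨w, hw, ?_, ?_⟩
  · obtain ⟨s, hs, hgw, hgle⟩ := exists_gap_eq h hUc hne w
    refine le_antisymm ?_ (by simpa [pairing_zero_right] using hgle w hw)
    rw [hgw]
    -- the minimizing direction at the limit point is a competitor along the subsequence
    have hcont : Continuous fun w => - pairing (grad h w) (s - w) :=
      (continuous_pairing.comp
        ((continuous_grad h).prodMk (continuous_const.sub continuous_id))).neg
    refine le_of_tendsto_of_tendsto' ((hcont.tendsto w).comp hpw)
      (((tendsto_one_div_add_atTop_nhds_zero_nat (𝕜 := ℝ)).comp hρ.tendsto_atTop).add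
        (((tendsto_initWeight h1 hsum).comp hφρ).const_mul (-C)) |>.trans (by simp)) fun N => ?_
    obtain ⟨-, -, -, hgap⟩ := exists_gap_eq h hUc hne (p (φ (ρ N)) ω)
    have h2 := hgap s hs
    have h3 := hGφ (ρ N)
    simp only [hGdef, Function.comp_apply] at h2 h3 ⊢
    linarith
  · have h2 := ((contDiff_perf h (N := 0)).continuous.tendsto w).comp hpw
    rwa [← tendsto_nhds_unique (hl.comp hφρ) h2]

/-- If the limit of `Z(p_k)` is a value of `Z` attained in `U` only at `w`, the iterates converge to
`w`. -/
lemma IsRun.tendsto_of_tendsto_perf (hrun : IsRun h U p₁ ε R μ ℱ X p q)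
    (h0 : ∀ k, 0 ≤ ε k) (h1 : ∀ k, ε k < 1)
    (hsum : Tendsto (fun N => ∑ k ∈ Finset.range N, ε k) atTop atTop)
    (hUconv : Convex ℝ U) (hUc : IsCompact U) {ω : Ω} {w : Weights n}
    (hw : ∀ v ∈ U, perf h v = perf h w → v = w)
    (hlim : Tendsto (fun k => perf h (p k ω)) atTop (𝓝 (perf h w))) :
    Tendsto (fun k => p k ω) atTop (𝓝 w) := by
  choose u hu hpu using fun k => hrun.exists_eq_add h0 h1 hUconv k ω
  have ha := tendsto_initWeight h1 hsum
  refine tendsto_of_eq_initWeight_add hpu ha tendsto_id (hUc.tendsto_nhds_of_unique_mapClusterPt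
    (Eventually.of_forall hu) fun v hv hcl => hw v hv ?_)
  obtain ⟨φ, hφ, huφ⟩ := hcl.tendsto_subseq
  have hpφ := tendsto_of_eq_initWeight_add hpu ha hφ.tendsto_atTop huφ
  exact tendsto_nhds_unique (((contDiff_perf h (N := 0)).continuous.tendsto v).comp hpφ)
    (hlim.comp hφ.tendsto_atTop)

end Pathwise
end FWSA

theorem theorem6 {m : ℕ} {n T : Fin m → ℕ} (h : FWSA.Path n T → ℝ)
    -- the uncertainty sets: closed convex sets of probability vectors
    (U : (i : Fin m) → Set (Fin (n i) → ℝ))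
    (hU_simplex : ∀ i, U i ⊆ stdSimplex ℝ (Fin (n i)))
    (hU_convex : ∀ i, Convex ℝ (U i))
    (hU_closed : ∀ i, IsClosed (U i))
    -- the initial point: a vector of positive probability weights
    (p₁ : FWSA.Weights n) (hp₁ : p₁ ∈ FWSA.simplices n) (hp₁_pos : ∀ i j, 0 < p₁ i j)
    -- step sizes
    (ε : ℕ → ℝ) (hε_nonneg : ∀ k, 0 ≤ ε k) (hε_lt_one : ∀ k, ε k < 1)
    (hε_sum : Tendsto (fun N => ∑ k ∈ Finset.range N, ε k) atTop atTop)
    (hε_sq : Summable fun k => ε k ^ 2)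
    -- sample sizes
    (R : ℕ → ℕ) (hR_pos : ∀ k, 0 < R k)
    (hR : Summable fun k =>
      ε k / Real.sqrt (R k) * ∏ j ∈ Finset.range k, (1 - ε j) ^ (-(1 / 2) : ℝ))
    -- a run of the algorithm
    {Ω : Type*} [MeasurableSpace Ω] (μ : Measure Ω) [IsProbabilityMeasure μ]
    (ℱ : Filtration ℕ ‹MeasurableSpace Ω›)
    (X : (k : ℕ) → Ω → Fin (R k) → FWSA.Path n T) (p q : ℕ → Ω → FWSA.Weights n)
    (hrun : FWSA.IsRun h (Set.univ.pi U) p₁ ε R μ ℱ X p q) :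
    -- part 1
    (ContinuousOn (FWSA.gap h (Set.univ.pi U)) (Set.univ.pi U) →
      (∃ p', FWSA.IsMinimizer (FWSA.perf h) (Set.univ.pi U) p') →
      (FWSA.perf h '' {p' ∈ Set.univ.pi U | FWSA.gap h (Set.univ.pi U) p' = 0}).Nonempty ∧
      ∀ᵐ ω ∂μ, Tendsto
        (fun k => Metric.infDist (FWSA.perf h (p k ω))
          (FWSA.perf h '' {p' ∈ Set.univ.pi U | FWSA.gap h (Set.univ.pi U) p' = 0}))
        atTop (𝓝 0)) ∧
    -- part 2
    (∀ pstar : FWSA.Weights n,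
      (∀ p', FWSA.IsMinimizer (FWSA.perf h) (Set.univ.pi U) p' ↔ p' = pstar) →
      ContinuousOn (FWSA.gap h (Set.univ.pi U)) (Set.univ.pi U) →
      (∀ p' ∈ Set.univ.pi U, FWSA.gap h (Set.univ.pi U) p' = 0 ↔ p' = pstar) →
      ∀ᵐ ω ∂μ, Tendsto (fun k => p k ω) atTop (𝓝 pstar)) := by
  have hne : Set.univ.pi U ⊆ FWSA.simplices n := Set.pi_mono fun i _ => hU_simplex i
  have hconv : Convex ℝ (Set.univ.pi U) := convex_pi fun i _ => hU_convex i
  have hcomp : IsCompact (Set.univ.pi U) :=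
    FWSA.isCompact_simplices.of_isClosed_subset (isClosed_set_pi fun i _ => hU_closed i) hne
  have hae : ∀ᵐ ω ∂μ, ∃ w ∈ Set.univ.pi U, FWSA.gap h (Set.univ.pi U) w = 0 ∧
      Tendsto (fun k => FWSA.perf h (p k ω)) atTop (𝓝 (FWSA.perf h w)) := by
    filter_upwards [hrun.ae_summable_noise hε_nonneg hε_lt_one hne hp₁ hp₁_pos hR_pos hR]
      with ω hω
    exact hrun.exists_gap_eq_zero_and_tendsto hε_nonneg hε_lt_one hε_sum hε_sq hne hconv hcomp
      hp₁ hω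
  refine ⟨fun _ _ => ⟨?_, ?_⟩, fun pstar hmin _ hzero => ?_⟩
  · obtain ⟨ω, w, hw, hgw, -⟩ := hae.exists
    exact ⟨_, w, ⟨hw, hgw⟩, rfl⟩
  · filter_upwards [hae] with ω ⟨w, hw, hgw, hlim⟩
    exact squeeze_zero (fun k => Metric.infDist_nonneg)
      (fun k => Metric.infDist_le_dist_of_mem (Set.mem_image_of_mem _ ⟨hw, hgw⟩))
      (tendsto_iff_dist_tendsto_zero.1 hlim)
  · filter_upwards [hae] with ω ⟨w, hw, hgw, hlim⟩
    rw [(hzero w hw).1 hgw] at hlim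
    refine hrun.tendsto_of_tendsto_perf hε_nonneg hε_lt_one hε_sum hconv hcomp
      (fun v hv hval => (hmin v).1 ⟨hv, fun r hr => ?_⟩) hlim
    rw [hval]
    exact ((hmin pstar).2 rfl).2 r hr
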